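/- Let $G$ be a (finite-dimensional, real) Lie group, $H\subseteq G$ a closed subgroup, and $G/H$ the homogeneous space with its smooth structure, on which $G$ acts smoothly by left translations. Metrics are smooth pseudo-Riemannian metrics of arbitrary signature; two metrics are affinely equivalent if their Levi-Civita connections coincide. A metric $g$ on a manifold $M$ is called decomposable if there is a smooth distribution $D\subseteq TM$, parallel for the Levi-Civita connection of $g$, on which $g$ is nondegenerate and with $0\neq D_x\neq T_xM$ for every $x\in M$; otherwise $g$ is called indecomposable. Let $g$ be a $G$-invariant Riemannian (positive definite) metric on $G/H$ that is indecomposable. Then $g$ is invariantly rigid: for every $G$-invariant metric $\bar g$ on $G/H$, of any signature, that is affinely equivalent to $g$, there is a constant $\lambda\in\mathbb R$, $\lambda\neq 0$, with $\bar g=\lambda g$ on all of $G/H$. -/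

import Mathlib

open Bundle Set Topology
open scoped Manifold ContDiff

namespace InvMetric

/-- A smooth pseudo-Riemannian metric (of arbitrary signature) on the manifold `M` modelled on the
vector space `E`: a smooth field of nondegenerate symmetric bilinear forms on the tangent spaces. -/
structure PseudoRiemannianMetric (E : Type*) [NormedAddCommGroup E] [NormedSpace ℝ E]
    (M : Type*) [TopologicalSpace M] [ChartedSpace E M] [IsManifold 𝓘(ℝ, E) ∞ M] where
  /-- The bilinear form on each tangent space. -/
  inner (x : M) : TangentSpace 𝓘(ℝ, E) x →L[ℝ] TangentSpace 𝓘(ℝ, E) x →L[ℝ] ℝ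
  symm (x : M) (v w : TangentSpace 𝓘(ℝ, E) x) : inner x v w = inner x w v
  nondegenerate (x : M) (v : TangentSpace 𝓘(ℝ, E) x) (hv : ∀ w, inner x v w = 0) : v = 0
  contMDiff : ContMDiff 𝓘(ℝ, E) (𝓘(ℝ, E).prod 𝓘(ℝ, E →L[ℝ] E →L[ℝ] ℝ)) ∞
    (fun x ↦ TotalSpace.mk' (E →L[ℝ] E →L[ℝ] ℝ)
      (E := fun x : M ↦ TangentSpace 𝓘(ℝ, E) x →L[ℝ] TangentSpace 𝓘(ℝ, E) x →L[ℝ] ℝ)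
      x (inner x))

section

variable {E : Type*} [NormedAddCommGroup E] [NormedSpace ℝ E]
  {M : Type*} [TopologicalSpace M] [ChartedSpace E M] [IsManifold 𝓘(ℝ, E) ∞ M]

/-- The metric is Riemannian: positive definite on every tangent space. -/
def PseudoRiemannianMetric.IsRiemannian (g : PseudoRiemannianMetric E M) : Prop :=
  ∀ (x : M) (v : TangentSpace 𝓘(ℝ, E) x), v ≠ 0 → 0 < g.inner x v v

/-- The metric is `G`-invariant: every element `a` of the group acts as an isometry. -/
def PseudoRiemannianMetric.IsInvariant (G : Type*) [Group G] [MulAction G M]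
    (g : PseudoRiemannianMetric E M) : Prop :=
  ∀ (a : G) (x : M) (v w : TangentSpace 𝓘(ℝ, E) x),
    g.inner (a • x) (mfderiv 𝓘(ℝ, E) 𝓘(ℝ, E) (fun y : M ↦ a • y) x v)
      (mfderiv 𝓘(ℝ, E) 𝓘(ℝ, E) (fun y : M ↦ a • y) x w) = g.inner x v w

/-- The connection `cov` on `TM` is a Levi-Civita connection of `g`: it is torsion-free,
`∇_X Y - ∇_Y X = [X, Y]`, and metric, `v (g (Y, Z)) = g (∇_v Y, Z) + g (Y, ∇_v Z)`.
Here `cov Y x v` is the derivative `∇_v Y` at `x`. -/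
structure IsLeviCivita (cov : CovariantDerivative 𝓘(ℝ, E) E (TangentSpace 𝓘(ℝ, E) : M → Type _))
    (g : PseudoRiemannianMetric E M) : Prop where
  torsion_free : ∀ (X Y : Π x : M, TangentSpace 𝓘(ℝ, E) x) (x : M),
    MDiffAt (T% X) x → MDiffAt (T% Y) x →
      cov Y x (X x) - cov X x (Y x) = VectorField.mlieBracket 𝓘(ℝ, E) X Y x
  metric : ∀ (Y Z : Π x : M, TangentSpace 𝓘(ℝ, E) x) (x : M),
    MDiffAt (T% Y) x → MDiffAt (T% Z) x → ∀ v : TangentSpace 𝓘(ℝ, E) x,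
      d% (fun y : M ↦ g.inner y (Y y) (Z y)) x v =
        g.inner x (cov Y x v) (Z x) + g.inner x (Y x) (cov Z x v)

/-- Two metrics are affinely equivalent if their Levi-Civita connections coincide. -/
def AffinelyEquivalent (g g' : PseudoRiemannianMetric E M) : Prop :=
  ∃ cov : CovariantDerivative 𝓘(ℝ, E) E (TangentSpace 𝓘(ℝ, E) : M → Type _),
    IsLeviCivita cov g ∧ IsLeviCivita cov g'

/-- A family of subspaces of the tangent spaces is a smooth distribution (a smooth subbundle of
`TM`) if near every point it is spanned by a smooth frame. -/
def IsSmoothDistribution (D : Π x : M, Submodule ℝ (TangentSpace 𝓘(ℝ, E) x)) : Prop :=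
  ∀ x : M, ∃ (k : ℕ) (Y : Fin k → Π y : M, TangentSpace 𝓘(ℝ, E) y) (U : Set M),
    IsOpen U ∧ x ∈ U ∧ (∀ i, CMDiff[U] ∞ (T% (Y i))) ∧
      ∀ y ∈ U, LinearIndependent ℝ (fun i ↦ Y i y) ∧
        Submodule.span ℝ (range fun i ↦ Y i y) = D y

/-- A distribution is parallel for the connection `cov` if the covariant derivatives of its local
smooth sections, in all directions, stay in the distribution. -/
def IsParallelDistribution
    (cov : CovariantDerivative 𝓘(ℝ, E) E (TangentSpace 𝓘(ℝ, E) : M → Type _))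
    (D : Π x : M, Submodule ℝ (TangentSpace 𝓘(ℝ, E) x)) : Prop :=
  ∀ (U : Set M) (Y : Π x : M, TangentSpace 𝓘(ℝ, E) x), IsOpen U → CMDiff[U] ∞ (T% Y) →
    (∀ x ∈ U, Y x ∈ D x) → ∀ x ∈ U, ∀ v : TangentSpace 𝓘(ℝ, E) x, cov Y x v ∈ D x

/-- A metric is decomposable if the manifold carries a smooth distribution, parallel for the
Levi-Civita connection, on which the metric is nondegenerate, and which is neither zero nor the
whole tangent space (equivalently for a connected manifold: the holonomy group preserves a proper
nonzero nondegenerate subspace). -/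
def PseudoRiemannianMetric.IsDecomposable (g : PseudoRiemannianMetric E M) : Prop :=
  ∃ (cov : CovariantDerivative 𝓘(ℝ, E) E (TangentSpace 𝓘(ℝ, E) : M → Type _))
    (D : Π x : M, Submodule ℝ (TangentSpace 𝓘(ℝ, E) x)),
    IsLeviCivita cov g ∧ IsSmoothDistribution D ∧ IsParallelDistribution cov D ∧
      (∀ x, ∀ v ∈ D x, (∀ w ∈ D x, g.inner x v w = 0) → v = 0) ∧
      ∀ x, D x ≠ ⊥ ∧ D x ≠ ⊤

/-- A metric is indecomposable if it is not decomposable. -/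
def PseudoRiemannianMetric.IsIndecomposable (g : PseudoRiemannianMetric E M) : Prop :=
  ¬ g.IsDecomposable

/-- A metric `g` is invariantly rigid if the only `G`-invariant metrics (of any signature) that are
affinely equivalent to `g` are the metrics `c • g` with a constant `c ≠ 0`. -/
def PseudoRiemannianMetric.IsInvariantlyRigid (G : Type*) [Group G] [MulAction G M]
    (g : PseudoRiemannianMetric E M) : Prop :=
  ∀ g' : PseudoRiemannianMetric E M, g'.IsInvariant G → AffinelyEquivalent g g' →
    ∃ c : ℝ, c ≠ 0 ∧ ∀ (x : M) (v w : TangentSpace 𝓘(ℝ, E) x),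
      g'.inner x v w = c * g.inner x v w

end

end InvMetric

/-! ### Linear algebra: relative eigenvectors and kernels of constant rank. -/

namespace InvMetric

/-! Let `g'` be invariant with the same connection as `g`. At one point, `g' = g(T·, ·)` with `T`
self-adjoint for the inner product `g`, so `T` has a real eigenvalue `c`
(`exists_relative_eigenvector`). Consider the field `D` of kernels of `g' - c g`, with this fixed
`c`. Invariance and transitivity carry `D` from the chosen point to every other
(`relativeEigenspace_smul`), so its rank is constant and positive. Constant rank makes `D` smooth
(`exists_contMDiffOn_frame_ker`); it is parallel because the common connection annihilates `g' - c
g`, and `g` is definite on it. Indecomposability leaves only `D = TM`, that is `g' = c g`, and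
nondegeneracy of `g'` excludes `c = 0`. -/

/-- A symmetric bilinear form has an eigenvector relative to a positive definite one. -/
lemma exists_relative_eigenvector {V : Type*} [AddCommGroup V] [Module ℝ V]
    [FiniteDimensional ℝ V] [Nontrivial V] (B B' : V →ₗ[ℝ] V →ₗ[ℝ] ℝ)
    (hsymm : ∀ v w, B v w = B w v) (hpos : ∀ v, v ≠ 0 → 0 < B v v)
    (hsymm' : ∀ v w, B' v w = B' w v) :
    ∃ (c : ℝ) (v : V), v ≠ 0 ∧ ∀ w, B' v w = c * B v w := by
  have hinj : Function.Injective B := by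
    rw [injective_iff_map_eq_zero]
    intro v hv
    by_contra hne
    have := hpos v hne
    simp [hv] at this
  let e : V ≃ₗ[ℝ] Module.Dual ℝ V :=
    LinearEquiv.ofInjectiveOfFinrankEq B hinj Subspace.dual_finrank_eq.symm
  let core : InnerProductSpace.Core ℝ V :=
    { inner := fun v w ↦ B v w
      conj_inner_symm := fun v w ↦ by simpa using hsymm w v
      re_inner_nonneg := fun v ↦ by
        by_cases hv : v = 0
        · simp [hv]
        · simpa using (hpos v hv).le
      add_left := fun u v w ↦ by simp
      smul_left := fun v w r ↦ by simp
      definite := fun v hv ↦ by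
        by_contra hne
        exact (hpos v hne).ne' hv }
  let _ : NormedAddCommGroup V := core.toNormedAddCommGroup
  let _ : InnerProductSpace ℝ V := InnerProductSpace.ofCore core.toCore
  -- `T = B⁻¹ B'`, self-adjoint for the inner product `B`.
  let T : V →ₗ[ℝ] V := e.symm.toLinearMap ∘ₗ B'
  have hT : ∀ v w, B (T v) w = B' v w := fun v w ↦
    LinearMap.congr_fun (e.apply_symm_apply (B' v)) w
  have hTs : T.IsSymmetric := fun v w ↦ by
    change B (T v) w = B v (T w)
    rw [hT, hsymm v, hT, hsymm']
  obtain ⟨c, hc⟩ : ∃ c : ℝ, Module.End.HasEigenvalue T c :=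
    ⟨_, hTs.hasEigenvalue_iSup_of_finiteDimensional⟩
  obtain ⟨v, hv⟩ := hc.exists_hasEigenvector
  refine ⟨c, v, hv.2, fun w ↦ ?_⟩
  rw [← hT, hv.apply_eq_smul]
  simp

/-- The kernels of a smooth family of linear maps of constant rank have a smooth local frame. -/
lemma exists_contMDiffOn_frame_ker
    {E : Type*} [NormedAddCommGroup E] [NormedSpace ℝ E] [FiniteDimensional ℝ E]
    {F : Type*} [NormedAddCommGroup F] [NormedSpace ℝ F] [FiniteDimensional ℝ F]
    {E₁ : Type*} [NormedAddCommGroup E₁] [NormedSpace ℝ E₁]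
    {M : Type*} [TopologicalSpace M] [ChartedSpace E₁ M] {V : Set M} (hV : IsOpen V)
    {A : M → E →L[ℝ] F} (hA : ContMDiffOn 𝓘(ℝ, E₁) 𝓘(ℝ, E →L[ℝ] F) ∞ A V) {x : M} (hx : x ∈ V)
    (hrank : ∀ y ∈ V, Module.finrank ℝ (A y).ker = Module.finrank ℝ (A x).ker) :
    ∃ (k : ℕ) (Y : Fin k → M → E) (U : Set M), IsOpen U ∧ x ∈ U ∧ U ⊆ V ∧
      (∀ i, ContMDiffOn 𝓘(ℝ, E₁) 𝓘(ℝ, E) ∞ (Y i) U) ∧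
      ∀ y ∈ U, LinearIndependent ℝ (fun i ↦ Y i y) ∧
        Submodule.span ℝ (range fun i ↦ Y i y) = (A y).ker := by
  have : CompleteSpace E := FiniteDimensional.complete ℝ E
  set K : Submodule ℝ E := (A x).ker with hK
  obtain ⟨p, hp⟩ := K.subtype.exists_leftInverse_of_injective K.ker_subtype
  have hp' : ∀ k : K, p k = k := fun k ↦ LinearMap.congr_fun hp k
  obtain ⟨R, hR⟩ := ((A x).toLinearMap.prod p).exists_leftInverse_of_injective (by
    rw [LinearMap.ker_eq_bot']
    intro v hv
    have h1 : A x v = 0 := congrArg Prod.fst hv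
    have h2 : p v = 0 := congrArg Prod.snd hv
    have := hp' ⟨v, h1⟩
    rw [h2] at this
    exact (congrArg Subtype.val this).symm)
  have hR' : ∀ v, R (A x v, p v) = v := fun v ↦ LinearMap.congr_fun hR v
  let R₁ : F →L[ℝ] E := (R ∘ₗ LinearMap.inl ℝ F K).toContinuousLinearMap
  let S : E →L[ℝ] E := (R ∘ₗ LinearMap.inr ℝ F K ∘ₗ p).toContinuousLinearMap
  -- `R` is a left inverse of `(A x, p)`, so `T x = 1` and `T y = R ∘ (A y, p)` stays invertible
  -- near `x`.
  let T : M → E →L[ℝ] E := fun y ↦ R₁ ∘L A y + S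
  have hT : ∀ y v, T y v = R (A y v, p v) := fun y v ↦ by
    change R (A y v, 0) + R (0, p v) = _
    rw [← map_add]; simp
  have hTx : T x = 1 := by ext v; simp [hT, hR']
  have hTs : ContMDiffOn 𝓘(ℝ, E₁) 𝓘(ℝ, E →L[ℝ] E) ∞ T V :=
    (contMDiffOn_const.clm_comp hA).add contMDiffOn_const
  let U : Set M := V ∩ T ⁻¹' {f | IsUnit f}
  -- On the kernel of `A y` the map `T y` reduces to the projection `p` onto `K`. Being injective,
  -- with ranks equal, it identifies the two kernels, so `(T y)⁻¹` carries a basis of `K` to the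
  -- required frame.
  have hTker : ∀ y, ∀ v ∈ (A y).ker, T y v ∈ K := fun y v hv ↦ by
    have h0 : A y v = 0 := hv
    have h1 := hR' (p v : E)
    have h2 : A x (p v : E) = 0 := (p v).2
    rw [hp', h2] at h1
    rw [hT, h0, h1]
    exact (p v).2
  let b := Module.finBasis ℝ K
  refine ⟨_, fun i y ↦ Ring.inverse (T y) (b i), U,
    hTs.continuousOn.isOpen_inter_preimage hV Units.isOpen, ⟨hx, by simp [hTx]⟩,
    inter_subset_left, fun i y hy ↦ ?_, fun y hy ↦ ?_⟩
  · obtain ⟨u, hu⟩ := hy.2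
    have h1 : ContMDiffWithinAt 𝓘(ℝ, E₁) 𝓘(ℝ, E →L[ℝ] E) ∞ (fun y ↦ Ring.inverse (T y)) U y :=
      ContMDiffAt.comp_contMDiffWithinAt y
        (hu ▸ (contDiffAt_ringInverse ℝ u).contMDiffAt) ((hTs y hy.1).mono inter_subset_left)
    exact h1.clm_apply contMDiffWithinAt_const
  · have hu : IsUnit (T y) := hy.2
    have hTi : ∀ v, Ring.inverse (T y) (T y v) = v := fun v ↦
      DFunLike.congr_fun (Ring.inverse_mul_cancel _ hu) v
    have hiT : ∀ v, T y (Ring.inverse (T y) v) = v := fun v ↦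
      DFunLike.congr_fun (Ring.mul_inverse_cancel _ hu) v
    have hli : LinearIndependent ℝ (fun i ↦ Ring.inverse (T y) (b i)) := by
      have h1 : LinearIndependent ℝ (fun i ↦ (b i : E)) :=
        b.linearIndependent.map' K.subtype K.ker_subtype
      refine h1.map' (Ring.inverse (T y)).toLinearMap ?_
      exact LinearMap.ker_eq_bot.2 (Function.LeftInverse.injective (g := T y) hiT)
    refine ⟨hli, (Submodule.eq_of_le_of_finrank_le ?_ ?_).symm⟩
    · intro v hv
      have h1 : (⟨T y v, hTker y v hv⟩ : K) ∈ Submodule.span ℝ (range b) := by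
        rw [b.span_eq]; trivial
      have h2 := Submodule.mem_map_of_mem
        (f := (Ring.inverse (T y)).toLinearMap ∘ₗ K.subtype) h1
      rw [Submodule.map_span, ← range_comp] at h2
      have h3 : ((Ring.inverse (T y)).toLinearMap ∘ₗ K.subtype) ⟨T y v, hTker y v hv⟩ = v := hTi v
      rwa [h3] at h2
    · rw [finrank_span_eq_card hli, Fintype.card_fin, hrank y hy.1]

/-! ### The eigendistribution of two metrics. -/

section

variable {E : Type*} [NormedAddCommGroup E] [NormedSpace ℝ E]
  {M : Type*} [TopologicalSpace M] [ChartedSpace E M] [IsManifold 𝓘(ℝ, E) ∞ M]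

/-- The eigendistribution of `g'` relative to `g` for the eigenvalue `c`. -/
def relativeEigenspace (g g' : PseudoRiemannianMetric E M) (c : ℝ) (x : M) :
    Submodule ℝ (TangentSpace 𝓘(ℝ, E) x) where
  carrier := {v | ∀ w, g'.inner x v w = c * g.inner x v w}
  add_mem' {u v} hu hv w := by
    simp only [map_add, add_apply, hu w, hv w, mul_add]
  zero_mem' w := by simp
  smul_mem' r v hv w := by
    simp only [map_smul, smul_apply, hv w, smul_eq_mul]; ring

lemma mem_relativeEigenspace {g g' : PseudoRiemannianMetric E M} {c : ℝ} {x : M}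
    {v : TangentSpace 𝓘(ℝ, E) x} :
    v ∈ relativeEigenspace g g' c x ↔ ∀ w, g'.inner x v w = c * g.inner x v w := Iff.rfl

lemma PseudoRiemannianMetric.mdifferentiableAt_inner_apply (g : PseudoRiemannianMetric E M) {x : M}
    {Y Z : Π y : M, TangentSpace 𝓘(ℝ, E) y} (hY : MDiffAt (T% Y) x) (hZ : MDiffAt (T% Z) x) :
    MDiffAt (fun y ↦ g.inner y (Y y) (Z y)) x := by
  have h : MDifferentiableAt 𝓘(ℝ, E) (𝓘(ℝ, E).prod 𝓘(ℝ, ℝ))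
      (fun y ↦ TotalSpace.mk' ℝ (E := Bundle.Trivial M ℝ) y (g.inner y (Y y) (Z y))) x :=
    MDifferentiableAt.clm_bundle_apply₂ (F₁ := E) (F₂ := E)
      ((g.contMDiff x).mdifferentiableAt (by simp)) hY hZ
  simpa [mdifferentiableAt_section] using h

/-- Differentiate `g'(Y, Z) = c g(Y, Z)` using both metric identities: the terms containing `∇Z`
cancel because `Y` lies in the eigenspace, leaving `g'(∇Y, Z) = c g(∇Y, Z)`. -/
lemma isParallelDistribution_relativeEigenspace [FiniteDimensional ℝ E]
    {g g' : PseudoRiemannianMetric E M}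
    {cov : CovariantDerivative 𝓘(ℝ, E) E (TangentSpace 𝓘(ℝ, E) : M → Type _)}
    (h : IsLeviCivita cov g) (h' : IsLeviCivita cov g') (c : ℝ) :
    IsParallelDistribution cov (relativeEigenspace g g' c) := by
  intro U Y hU hY hYD x hx v w
  -- The metric identity needs a vector field, so `w` is extended to one differentiable at `x`.
  set Z : Π y : M, TangentSpace 𝓘(ℝ, E) y := FiberBundle.extend E w with hZdef
  have hZ : MDiffAt (T% Z) x := FiberBundle.mdifferentiableAt_extend 𝓘(ℝ, E) E w
  have hZx : Z x = w := FiberBundle.extend_apply_self E w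
  have hYx : MDiffAt (T% Y) x :=
    ((hY x hx).contMDiffAt (hU.mem_nhds hx)).mdifferentiableAt (by simp)
  have e := h.metric Y Z x hYx hZ v
  have e' := h'.metric Y Z x hYx hZ v
  have hd : d% (fun y : M ↦ g'.inner y (Y y) (Z y)) x v
      = c * d% (fun y : M ↦ g.inner y (Y y) (Z y)) x v := by
    have heq : (fun y : M ↦ g'.inner y (Y y) (Z y)) =ᶠ[𝓝 x]
        fun y ↦ c * g.inner y (Y y) (Z y) := by
      filter_upwards [hU.mem_nhds hx] with y hy using hYD y hy (Z y)
    have h1 : d% (fun y : M ↦ g'.inner y (Y y) (Z y)) x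
        = d% (fun y : M ↦ c * g.inner y (Y y) (Z y)) x := heq.mfderiv_eq
    rw [h1, mvfderiv_fun_mul mdifferentiableAt_const (g.mdifferentiableAt_inner_apply hYx hZ),
      mvfderiv_const]
    simp
  rw [e, e', hZx, hYD x hx, mul_add] at hd
  exact add_right_cancel hd

-- In a trivialization of the tangent bundle the eigenspaces are the kernels of the smooth matrix
-- field `g' - c g`, to which the constant-rank lemma applies.
set_option synthInstance.maxHeartbeats 200000 in
lemma isSmoothDistribution_relativeEigenspace [FiniteDimensional ℝ E]
    (g g' : PseudoRiemannianMetric E M) (c : ℝ)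
    (hrank : ∀ x y, Module.finrank ℝ (relativeEigenspace g g' c x) =
      Module.finrank ℝ (relativeEigenspace g g' c y)) :
    IsSmoothDistribution (relativeEigenspace g g' c) := by
  intro x
  let e := trivializationAt E (TangentSpace 𝓘(ℝ, E) : M → Type _) x
  have hxe : x ∈ e.baseSet := mem_baseSet_trivializationAt E _ x
  let A (h : PseudoRiemannianMetric E M) (y : M) : E →L[ℝ] E →L[ℝ] ℝ :=
    ContinuousLinearMap.inCoordinates E (TangentSpace 𝓘(ℝ, E) : M → Type _) (E →L[ℝ] ℝ)
      (fun y : M ↦ TangentSpace 𝓘(ℝ, E) y →L[ℝ] ℝ) x y x y (h.inner y)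
  have hA : ∀ h, ContMDiffOn 𝓘(ℝ, E) 𝓘(ℝ, E →L[ℝ] E →L[ℝ] ℝ) ∞ (A h) e.baseSet := fun h ↦ by
    have hsub : e.baseSet ⊆ (trivializationAt (E →L[ℝ] E →L[ℝ] ℝ)
        (fun y : M ↦ TangentSpace 𝓘(ℝ, E) y →L[ℝ] TangentSpace 𝓘(ℝ, E) y →L[ℝ] ℝ) x).baseSet :=
      fun y hy ↦ ⟨hy, hy, mem_univ y⟩
    have h1 := (Trivialization.contMDiffOn_section_iff (n := ∞) (IB := 𝓘(ℝ, E)) (s := h.inner)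
      (trivializationAt (E →L[ℝ] E →L[ℝ] ℝ)
        (fun y : M ↦ TangentSpace 𝓘(ℝ, E) y →L[ℝ] TangentSpace 𝓘(ℝ, E) y →L[ℝ] ℝ) x)
        e.open_baseSet hsub).1 h.contMDiff.contMDiffOn
    exact h1
  have hAapp : ∀ h, ∀ y ∈ e.baseSet, ∀ v w, A h y v w = h.inner y (e.symm y v) (e.symm y w) :=
    fun h y hy v w ↦ by
      simp only [A]
      rw [inCoordinates_apply_eq₂ hy hy (mem_univ _)]
      simp [e]
  let B (y : M) : E →L[ℝ] E →L[ℝ] ℝ := A g' y - c • A g y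
  have hB : ContMDiffOn 𝓘(ℝ, E) 𝓘(ℝ, E →L[ℝ] E →L[ℝ] ℝ) ∞ B e.baseSet :=
    (hA g').sub ((contDiff_const_smul c).contMDiff.comp_contMDiffOn (hA g))
  let L (y : M) (hy : y ∈ e.baseSet) := (e.continuousLinearEquivAt ℝ y hy).symm.toLinearEquiv
  have hL : ∀ y hy v, L y hy v = e.symm y v := fun y hy v ↦ rfl
  have hD : ∀ y hy, (B y).ker.map (L y hy).toLinearMap = relativeEigenspace g g' c y := by
    intro y hy
    ext u
    rw [Submodule.mem_map_equiv, LinearMap.mem_ker, mem_relativeEigenspace]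
    have hu : e.symm y ((L y hy).symm u) = u := (L y hy).apply_symm_apply u
    constructor
    · intro h w
      have h1 : B y ((L y hy).symm u) ((L y hy).symm w) = 0 := DFunLike.congr_fun h _
      have hw : e.symm y ((L y hy).symm w) = w := (L y hy).apply_symm_apply w
      simp only [B, sub_apply, smul_apply, smul_eq_mul, hAapp _ y hy, hu, hw] at h1
      exact sub_eq_zero.1 h1
    · intro h
      ext w
      change B y ((L y hy).symm u) w = 0
      simp only [B, sub_apply, smul_apply, smul_eq_mul, hAapp _ y hy, hu]
      exact sub_eq_zero.2 (h _)
  have hfr : ∀ y ∈ e.baseSet, Module.finrank ℝ (B y).ker =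
      Module.finrank ℝ (relativeEigenspace g g' c y) := fun y hy ↦ by
    rw [← hD y hy]
    exact (LinearEquiv.finrank_map_eq (L y hy) _).symm
  obtain ⟨k, Y, U, hU, hxU, hUe, hY, hYB⟩ := exists_contMDiffOn_frame_ker e.open_baseSet
    hB hxe
    (fun y hy ↦ (hfr y hy).trans ((hrank y x).trans (hfr x hxe).symm))
  refine ⟨k, fun i y ↦ e.symm y (Y i y), U, hU, hxU, fun i ↦ ?_, fun y hy ↦ ?_⟩
  · rw [e.contMDiffOn_section_iff hU hUe]
    refine (hY i).congr fun y hy ↦ ?_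
    rw [e.apply_mk_symm (hUe hy)]
  · have hye := hUe hy
    refine ⟨(hYB y hy).1.map' (L y hye).toLinearMap (L y hye).ker, ?_⟩
    rw [← hD y hye]
    have := congrArg (Submodule.map (L y hye).toLinearMap) (hYB y hy).2
    rw [Submodule.map_span, ← range_comp] at this
    exact this

/-- Eigenspaces of invariant metrics are mapped to each other by the action. -/
lemma relativeEigenspace_smul {G : Type*} [Group G] [MulAction G M]
    {g g' : PseudoRiemannianMetric E M} (hg : g.IsInvariant G) (hg' : g'.IsInvariant G)
    (hG : ∀ a : G, ContMDiff 𝓘(ℝ, E) 𝓘(ℝ, E) ∞ (fun y : M ↦ a • y)) (c : ℝ) (a : G) (x : M) :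
    ∃ L : TangentSpace 𝓘(ℝ, E) x ≃ₗ[ℝ] TangentSpace 𝓘(ℝ, E) (a • x),
      (relativeEigenspace g g' c x).map L.toLinearMap = relativeEigenspace g g' c (a • x) := by
  let d : Diffeomorph 𝓘(ℝ, E) 𝓘(ℝ, E) M M ∞ :=
    { toEquiv := MulAction.toPerm a
      contMDiff_toFun := hG a
      contMDiff_invFun := hG a⁻¹ }
  let L : TangentSpace 𝓘(ℝ, E) x ≃ₗ[ℝ] TangentSpace 𝓘(ℝ, E) (a • x) :=
    (d.mfderivToContinuousLinearEquiv (by simp) x).toLinearEquiv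
  have hL : ∀ v, L v = mfderiv 𝓘(ℝ, E) 𝓘(ℝ, E) (fun y : M ↦ a • y) x v := fun v ↦ rfl
  have h1 : ∀ v w, g.inner (a • x) (L v) (L w) = g.inner x v w := hg a x
  have h1' : ∀ v w, g'.inner (a • x) (L v) (L w) = g'.inner x v w := hg' a x
  refine ⟨L, ?_⟩
  ext u
  obtain ⟨v, rfl⟩ := L.surjective u
  rw [Submodule.mem_map_equiv, L.symm_apply_apply, mem_relativeEigenspace, mem_relativeEigenspace]
  refine ⟨fun h w ↦ ?_, fun h w ↦ ?_⟩
  · obtain ⟨w, rfl⟩ := L.surjective w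
    rw [h1, h1', h]
  · rw [← h1, ← h1', h]

/-- An indecomposable invariant Riemannian metric on a manifold with a smooth transitive action is
invariantly rigid. -/
theorem PseudoRiemannianMetric.IsIndecomposable.isInvariantlyRigid [FiniteDimensional ℝ E]
    {G : Type*} [Group G] [MulAction G M] [MulAction.IsPretransitive G M]
    (hG : ∀ a : G, ContMDiff 𝓘(ℝ, E) 𝓘(ℝ, E) ∞ (fun y : M ↦ a • y))
    {g : PseudoRiemannianMetric E M} (hg_ind : g.IsIndecomposable) (hg_inv : g.IsInvariant G)
    (hg_riem : g.IsRiemannian) : g.IsInvariantlyRigid G := by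
  rintro g' hg' ⟨cov, hcov, hcov'⟩
  rcases subsingleton_or_nontrivial E with hE | hE
  -- In dimension zero every constant works; there is no eigenvector to start from.
  · refine ⟨1, one_ne_zero, fun x v w ↦ ?_⟩
    have hv : v = 0 := hE.elim v 0
    simp [hv]
  rcases isEmpty_or_nonempty M with hM | ⟨⟨x⟩⟩
  · exact ⟨1, one_ne_zero, fun x ↦ hM.elim x⟩
  have : Nontrivial (TangentSpace 𝓘(ℝ, E) x) := hE
  have : FiniteDimensional ℝ (TangentSpace 𝓘(ℝ, E) x) := inferInstanceAs (FiniteDimensional ℝ E)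
  obtain ⟨c, v, hv, hvc⟩ := exists_relative_eigenvector (g.inner x).toLinearMap₁₂
    (g'.inner x).toLinearMap₁₂ (g.symm x) (hg_riem x) (g'.symm x)
  have hmap : ∀ y, ∃ L : TangentSpace 𝓘(ℝ, E) x ≃ₗ[ℝ] TangentSpace 𝓘(ℝ, E) y,
      (relativeEigenspace g g' c x).map L.toLinearMap = relativeEigenspace g g' c y := fun y ↦ by
    obtain ⟨a, rfl⟩ := MulAction.exists_smul_eq G x y
    exact relativeEigenspace_smul hg_inv hg' hG c a x
  by_cases htop : relativeEigenspace g g' c x = ⊤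
  · have hgc : ∀ y (v w : TangentSpace 𝓘(ℝ, E) y), g'.inner y v w = c * g.inner y v w := by
      intro y v
      obtain ⟨L, hL⟩ := hmap y
      rw [htop, Submodule.map_top, LinearEquiv.range] at hL
      exact mem_relativeEigenspace.1 (hL ▸ Submodule.mem_top)
    refine ⟨c, ?_, hgc⟩
    rintro rfl
    -- With `c = 0` the eigenvector `v` would lie in the radical of `g'`.
    exact hv (g'.nondegenerate x v fun w ↦ by simp [hgc])
  · refine absurd ⟨cov, relativeEigenspace g g' c, hcov,
      isSmoothDistribution_relativeEigenspace g g' c ?_,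
      isParallelDistribution_relativeEigenspace hcov hcov' c, ?_, fun y ↦ ?_⟩ hg_ind
    · have h (y : M) : Module.finrank ℝ (relativeEigenspace g g' c y) =
          Module.finrank ℝ (relativeEigenspace g g' c x) := by
        obtain ⟨L, hL⟩ := hmap y
        rw [← hL]
        exact LinearEquiv.finrank_map_eq L _
      exact fun y z ↦ (h y).trans (h z).symm
    · intro y v hv h
      by_contra hne
      exact (hg_riem y v hne).ne' (h v hv)
    · obtain ⟨L, hL⟩ := hmap y
      rw [← hL]
      refine ⟨fun h ↦ hv ?_, fun h ↦ htop ?_⟩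
      · have h1 : L v ∈ (relativeEigenspace g g' c x).map L.toLinearMap :=
          Submodule.mem_map_of_mem hvc
        rw [h, Submodule.mem_bot] at h1
        exact L.map_eq_zero_iff.1 h1
      · exact Submodule.map_injective_of_injective L.injective
          (h.trans (by rw [Submodule.map_top, LinearEquiv.range]))

end

end InvMetric

/-- Translations are smooth as restrictions of the jointly smooth action map, and the action on
cosets is transitive. -/
theorem proposition1
    {EG : Type*} [NormedAddCommGroup EG] [NormedSpace ℝ EG] [FiniteDimensional ℝ EG]
    {G : Type*} [TopologicalSpace G] [ChartedSpace EG G] [Group G] [LieGroup 𝓘(ℝ, EG) ∞ G]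
    (H : Subgroup G) (hH : IsClosed (H : Set G))
    {E : Type*} [NormedAddCommGroup E] [NormedSpace ℝ E] [FiniteDimensional ℝ E]
    [ChartedSpace E (G ⧸ H)] [IsManifold 𝓘(ℝ, E) ∞ (G ⧸ H)]
    [ContMDiffSMul 𝓘(ℝ, EG) 𝓘(ℝ, E) ∞ G (G ⧸ H)]
    (g : InvMetric.PseudoRiemannianMetric E (G ⧸ H))
    (hg_inv : g.IsInvariant G) (hg_riem : g.IsRiemannian) (hg_ind : g.IsIndecomposable) :
    g.IsInvariantlyRigid G := by
  refine hg_ind.isInvariantlyRigid (fun a ↦ ?_) hg_inv hg_riem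
  exact (contMDiff_smul (I := 𝓘(ℝ, EG)) (I' := 𝓘(ℝ, E)) (n := ∞) (G := G) (M := G ⧸ H)).comp
    (contMDiff_const.prodMk contMDiff_id)
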